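/- Let $S$ be a finite set of sellers, let $0\le t_0<t_f$, and write $L^2=L^2[t_0,t_f]$. Fix $\rho\in\mathbb R$, $\pi_{\min}\ge 0$, $\pi_{\max}>0$, $D_{\min}>0$, inventories $K_s\in\mathbb R$ and nonempty uncertainty sets $U_s\subseteq (L^2)^m$ ($s\in S$). A price $p\in L^2$ is called feasible if $\pi_{\min}\le p(t)\le\pi_{\max}$ for a.e. $t$. The observed demand for the output of seller $s$ is a function of current prices: for a price vector $\pi=(\pi_s,\pi_{-s})$ and $\xi\in U_s$ its value at time $t$ is $h_s(\pi_s,\pi_{-s};\xi)(t)=h_s(t,\pi(t);\xi)$. Assume that for every $s\in S$ and $\xi\in U_s$: (i) $h_s(\pi;\xi)\in L^2$ whenever all the prices in $\pi$ are feasible, and for a.e. $t$ the function $x\mapsto h_s(t,x;\xi)$ is continuous and concave on $[\pi_{\min},\pi_{\max}]^{S}$; (ii) $\sup_{\xi'\in U_s,\ \pi_{-s}\text{ feasible}}h_s(\pi_{\max},\pi_{-s};\xi')=0$ (supremum of functions of $t$, in the almost-everywhere order); (iii) for feasible $\pi_{-s}$ and feasible $\pi_s^1\ne\pi_s^2$,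 $$\int_{t_0}^{t_f}e^{-t}\bigl[h_s(\pi_s^1,\pi_{-s};\xi)-h_s(\pi_s^2,\pi_{-s};\xi)\bigr](\pi_s^1-\pi_s^2)\,dt<0 .$$ For $W\subseteq U_s$ and feasible $\pi_{-s}$ let $\Lambda_s(\pi_{-s},W)$ be the set of all $(\pi_s,D_s)\in L^2\times L^2$ such that $\pi_s$ is feasible, $\int_{t_0}^{t_f}D_s\,dt=K_s$, and, almost everywhere, $D_s\ge D_{\min}$ and, for each $\xi\in W$, $D_s\le h_s(\pi_s,\pi_{-s};\xi)$. Then for every seller $s$ and all feasible prices $\pi_{-s}$ of the other sellers the best response problem $$\max\int_{t_0}^{t_f}e^{-\rho t}\pi_s(t)D_s(t)\,dt\quad\text{s.t. }(\pi_s,D_s)\in\Lambda_s(\pi_{-s},W)$$ has a solution whenever its feasible set is nonempty, both for $W=\{\xi\}$ with any fixed $\xi\in U_s$, and for $W=U_s$. -/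

import Mathlib

open MeasureTheory

noncomputable section

/-- Lebesgue measure on the selling period `[t₀, tf]`. -/
abbrev periodMeasure (t₀ tf : ℝ) : Measure ℝ := volume.restrict (Set.Icc t₀ tf)

/-- The Hilbert space `L²[t₀, tf]`. -/
abbrev L2 (t₀ tf : ℝ) : Type := Lp ℝ 2 (periodMeasure t₀ tf)

/-- The data of a market with set of sellers `S`, uncertainty vectors in `(L²[t₀, tf])^m`. -/
structure Market (S : Type*) (m : ℕ) where
  /-- initial time -/
  t₀ : ℝ
  /-- terminal time -/
  tf : ℝ
  /-- nominal discount rate -/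
  ρ : ℝ
  /-- lower bound on prices -/
  pMin : ℝ
  /-- upper bound on prices -/
  pMax : ℝ
  /-- lower bound on realized demand -/
  dMin : ℝ
  /-- initial inventory of each seller -/
  K : S → ℝ
  /-- uncertainty set of each seller -/
  U : S → Set (Fin m → L2 t₀ tf)
  /-- observed demand: `h s t x ξ` is the demand for the output of seller `s` at time `t` when the
  current prices of the sellers are `x` and the uncertain parameter of the seller is `ξ` -/
  h : S → ℝ → (S → ℝ) → (Fin m → L2 t₀ tf) → ℝ

namespace Market

variable {S : Type*} {m : ℕ} (M : Market S m)

/-- Price and realized-demand trajectories. -/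
abbrev Traj : Type := L2 M.t₀ M.tf

/-- Uncertainty vectors. -/
abbrev Unc : Type := Fin m → L2 M.t₀ M.tf

/-- Prices of all sellers other than `s`. -/
abbrev Others (s : S) : Type _ := {r : S // r ≠ s} → M.Traj

/-- The price bounds, `pMin ≤ p(t) ≤ pMax` for almost every `t ∈ [t₀, tf]`. -/
def FeasiblePrice (p : M.Traj) : Prop :=
  ∀ᵐ t ∂(periodMeasure M.t₀ M.tf), M.pMin ≤ p t ∧ p t ≤ M.pMax

/-- The price vector at time `t` made of the own price `p` of seller `s` and the prices `q` of
the others. -/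
def priceAt [DecidableEq S] (s : S) (p : M.Traj) (q : M.Others s) (t : ℝ) : S → ℝ :=
  fun r => if hr : r = s then p t else q ⟨r, hr⟩ t

/-- The observed demand `h_s(p, q; ξ)` as a function of time. -/
def demand [DecidableEq S] (s : S) (p : M.Traj) (q : M.Others s) (ξ : M.Unc) (t : ℝ) : ℝ :=
  M.h s t (M.priceAt s p q t) ξ

/-- The regularity conditions on the market. -/
structure Regular [DecidableEq S] : Prop where
  t₀_nonneg : 0 ≤ M.t₀
  t₀_lt_tf : M.t₀ < M.tf
  U_nonempty : ∀ s, (M.U s).Nonempty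
  /-- observed demand is square integrable in time -/
  demand_memLp : ∀ s (p : M.Traj) (q : M.Others s), M.FeasiblePrice p →
    (∀ r, M.FeasiblePrice (q r)) → ∀ ξ ∈ M.U s,
      MemLp (M.demand s p q ξ) 2 (periodMeasure M.t₀ M.tf)
  /-- observed demand is continuous in current prices -/
  demand_continuous : ∀ s, ∀ ξ ∈ M.U s, ∀ᵐ t ∂(periodMeasure M.t₀ M.tf),
    ContinuousOn (fun x : S → ℝ => M.h s t x ξ) (Set.Icc (fun _ => M.pMin) (fun _ => M.pMax))
  pMin_nonneg : 0 ≤ M.pMin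
  pMax_pos : 0 < M.pMax
  /-- the supremum of `h_s(pMax, q; ξ)` over `q` and `ξ` is zero: it is an upper bound -/
  demand_pMax_le : ∀ s (p : M.Traj) (q : M.Others s),
    (∀ᵐ t ∂(periodMeasure M.t₀ M.tf), p t = M.pMax) → (∀ r, M.FeasiblePrice (q r)) →
    ∀ ξ ∈ M.U s, ∀ᵐ t ∂(periodMeasure M.t₀ M.tf), M.demand s p q ξ t ≤ 0
  /-- the supremum of `h_s(pMax, q; ξ)` over `q` and `ξ` is zero: it is the least upper bound -/
  demand_pMax_lub : ∀ s (p : M.Traj), (∀ᵐ t ∂(periodMeasure M.t₀ M.tf), p t = M.pMax) →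
    ∀ g : M.Traj, (∀ q : M.Others s, (∀ r, M.FeasiblePrice (q r)) → ∀ ξ ∈ M.U s,
      ∀ᵐ t ∂(periodMeasure M.t₀ M.tf), M.demand s p q ξ t ≤ g t) →
    ∀ᵐ t ∂(periodMeasure M.t₀ M.tf), 0 ≤ g t
  dMin_pos : 0 < M.dMin
  /-- observed demand is concave in prices -/
  demand_concave : ∀ s, ∀ ξ ∈ M.U s, ∀ᵐ t ∂(periodMeasure M.t₀ M.tf),
    ConcaveOn ℝ (Set.Icc (fun _ => M.pMin) (fun _ => M.pMax)) (fun x : S → ℝ => M.h s t x ξ)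
  /-- observed demand is strictly monotonically decreasing in own price -/
  demand_strictAnti : ∀ s (q : M.Others s), (∀ r, M.FeasiblePrice (q r)) → ∀ ξ ∈ M.U s,
    ∀ p₁ p₂ : M.Traj, M.FeasiblePrice p₁ → M.FeasiblePrice p₂ → p₁ ≠ p₂ →
      (∫ t in Set.Icc M.t₀ M.tf, Real.exp (-t) *
        ((M.demand s p₁ q ξ t - M.demand s p₂ q ξ t) * (p₁ t - p₂ t))) < 0

/-- The present value `J_s(p, D)` of the revenue of a seller. -/
def revenue (v : M.Traj × M.Traj) : ℝ :=
  ∫ t in Set.Icc M.t₀ M.tf, Real.exp (-M.ρ * t) * (v.1 t * v.2 t)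

/-- The strategy space: the pairs `(p, D)` of seller `s` that satisfy the price bounds, the inventory constraint,
the lower bound on realized demand, and `D ≤ h_s(p, q; ξ)` for every `ξ ∈ W`. -/
def strategySet [DecidableEq S] (s : S) (q : M.Others s) (W : Set M.Unc) :
    Set (M.Traj × M.Traj) :=
  {v | M.FeasiblePrice v.1 ∧
    (∫ t in Set.Icc M.t₀ M.tf, v.2 t) = M.K s ∧
    (∀ᵐ t ∂(periodMeasure M.t₀ M.tf), M.dMin ≤ v.2 t) ∧
    ∀ ξ ∈ W, ∀ᵐ t ∂(periodMeasure M.t₀ M.tf), v.2 t ≤ M.demand s v.1 q ξ t}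

end Market

end

/-! Revenue is bilinear, neither concave nor jointly weakly upper semicontinuous, so weak
compactness alone does not give a maximizer. What replaces concavity is
`Regular.exists_midpoint_strategy`: the best revenue attainable with a prescribed demand trajectory
is midpoint concave in that trajectory. Near-optimal demands thus form decreasing midpoint-convex
sets, and elements of almost minimal norm in them converge strongly to some `D₀`. With `D₀` fixed,
revenue is linear in the price, so the same selection applied to prices gives a strongly convergent
sequence. Strong convergence suffices to pass to the limit, because the strategy set is closed and
bounded (`exists_isMax_bilinear`). -/

open Filter Topology

/-! ### Strong convergence from near-minimal norms, and maximization of a bilinear form. -/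

section Hilbert

variable {H : Type*} [NormedAddCommGroup H] [InnerProductSpace ℝ H]

/-- A decreasing sequence of nonempty midpoint-convex sets in a ball of a Hilbert space admits a
convergent selection: take elements of almost minimal norm. -/
theorem exists_tendsto_of_antitone_midpoint_convex [CompleteSpace H] {E : ℕ → Set H}
    (hanti : Antitone E) (hne : ∀ n, (E n).Nonempty) {R : ℝ} (hR : ∀ n, ∀ x ∈ E n, ‖x‖ ≤ R)
    (hmid : ∀ n, ∀ x ∈ E n, ∀ y ∈ E n, (2⁻¹ : ℝ) • (x + y) ∈ E n) :
    ∃ (x : ℕ → H) (a : H), (∀ n, x n ∈ E n) ∧ Tendsto x atTop (𝓝 a) := by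
  set d : ℕ → ℝ := fun n => sInf ((fun x => ‖x‖ ^ 2) '' E n) with hd
  have hbdd : ∀ n, BddBelow ((fun x => ‖x‖ ^ 2) '' E n) := fun n =>
    ⟨0, by rintro _ ⟨x, -, rfl⟩; positivity⟩
  have hd_le : ∀ n, ∀ x ∈ E n, d n ≤ ‖x‖ ^ 2 := fun n x hx =>
    csInf_le (hbdd n) ⟨x, hx, rfl⟩
  have hd_mono : Monotone d := fun m n hmn =>
    csInf_le_csInf (hbdd m) ((hne n).image _) (Set.image_mono (hanti hmn))
  have hd_bdd : BddAbove (Set.range d) := by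
    refine ⟨R ^ 2, ?_⟩
    rintro _ ⟨n, rfl⟩
    obtain ⟨x, hx⟩ := hne n
    have h1 := hR n x hx
    exact (hd_le n x hx).trans (by gcongr)
  have hx : ∀ n : ℕ, ∃ x ∈ E n, ‖x‖ ^ 2 < d n + 1 / ((n : ℝ) + 1) := by
    intro n
    obtain ⟨_, ⟨x, hx, rfl⟩, hlt⟩ :=
      exists_lt_of_csInf_lt ((hne n).image (fun x => ‖x‖ ^ 2))
        (lt_add_of_pos_right (d n) (Nat.one_div_pos_of_nat (α := ℝ) (n := n)))
    exact ⟨x, hx, hlt⟩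
  choose x hxE hxd using hx
  have hlim : Tendsto d atTop (𝓝 (⨆ n, d n)) := tendsto_atTop_ciSup hd_mono hd_bdd
  -- Parallelogram law: the midpoint lies in `E N`, so its squared norm is at least `d N`, while
  -- both endpoints have squared norm at most `⨆ n, d n` plus `1 / (N + 1)`.
  have hdist : ∀ N n m : ℕ, N ≤ n → N ≤ m →
      ‖x n - x m‖ ^ 2 ≤ 4 * ((⨆ n, d n) - d N) + 4 * (1 / ((N : ℝ) + 1)) := by
    intro N n m hn hm
    have hpar := parallelogram_law_with_norm ℝ (x n) (x m)
    have hmidN := hd_le N _ (hmid N _ (hanti hn (hxE n)) _ (hanti hm (hxE m)))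
    rw [norm_smul, mul_pow] at hmidN
    norm_num at hmidN
    have h1 := le_ciSup hd_bdd n
    have h2 := le_ciSup hd_bdd m
    have h3 := hxd n
    have h4 := hxd m
    have h5 : 1 / ((n : ℝ) + 1) ≤ 1 / ((N : ℝ) + 1) := Nat.one_div_le_one_div hn
    have h6 : 1 / ((m : ℝ) + 1) ≤ 1 / ((N : ℝ) + 1) := Nat.one_div_le_one_div hm
    nlinarith
  have hlim0 : Tendsto (fun N : ℕ => 4 * ((⨆ n, d n) - d N) + 4 * (1 / ((N : ℝ) + 1))) atTop
      (𝓝 0) := by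
    have := (((tendsto_const_nhds (x := ⨆ n, d n)).sub hlim).const_mul 4).add
      ((tendsto_one_div_add_atTop_nhds_zero_nat (𝕜 := ℝ)).const_mul 4)
    simpa using this
  have hcauchy : CauchySeq x := by
    rw [Metric.cauchySeq_iff]
    intro ε hε
    obtain ⟨N, hN⟩ := (hlim0.eventually (gt_mem_nhds (show (0 : ℝ) < ε ^ 2 by positivity))).exists
    refine ⟨N, fun n hn m hm => ?_⟩
    rw [dist_eq_norm]
    exact lt_of_pow_lt_pow_left₀ 2 hε.le ((hdist N n m hn hm).trans_lt hN)
  obtain ⟨a, ha⟩ := cauchySeq_tendsto_of_complete hcauchy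
  exact ⟨x, a, hxE, ha⟩

/-- A bounded bilinear form attains its maximum on a nonempty, bounded, closed, convex set if the
midpoint of any two second coordinates can be complemented by a first coordinate whose value is at
least the mean of the values. -/
theorem exists_isMax_bilinear [CompleteSpace H] (B : H →L[ℝ] H →L[ℝ] ℝ) {C : Set (H × H)}
    (hne : C.Nonempty) (hclosed : IsClosed C) (hconv : Convex ℝ C) {R : ℝ}
    (hR : ∀ v ∈ C, ‖v.1‖ ≤ R ∧ ‖v.2‖ ≤ R)
    (hmid : ∀ v ∈ C, ∀ w ∈ C, ∃ p, (p, (2⁻¹ : ℝ) • (v.2 + w.2)) ∈ C ∧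
      (B v.1 v.2 + B w.1 w.2) / 2 ≤ B p ((2⁻¹ : ℝ) • (v.2 + w.2))) :
    ∃ v ∈ C, ∀ w ∈ C, B w.1 w.2 ≤ B v.1 v.2 := by
  have hRnn : 0 ≤ R := by
    obtain ⟨v, hv⟩ := hne
    exact (norm_nonneg _).trans (hR v hv).1
  have hBbound : ∀ p D : H, ‖p‖ ≤ R → |B p D| ≤ ‖B‖ * R * ‖D‖ := fun p D hp =>
    (B.le_opNorm₂ p D).trans (by gcongr)
  set V : Set ℝ := (fun v : H × H => B v.1 v.2) '' C with hV
  have hVbdd : BddAbove V := by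
    refine ⟨‖B‖ * R * R, ?_⟩
    rintro _ ⟨v, hv, rfl⟩
    refine (le_abs_self _).trans ((hBbound _ _ (hR v hv).1).trans ?_)
    have := (hR v hv).2
    gcongr
  set J : ℝ := sSup V with hJ
  have hmono : ∀ {m n : ℕ}, m ≤ n → 1 / ((n : ℝ) + 1) ≤ 1 / ((m : ℝ) + 1) :=
    fun h => Nat.one_div_le_one_div h
  obtain ⟨D, D₀, hD, hDlim⟩ := exists_tendsto_of_antitone_midpoint_convex
    (E := fun n : ℕ => {D : H | ∃ p, (p, D) ∈ C ∧ J - 1 / ((n : ℝ) + 1) ≤ B p D}) (R := R)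
    (by
      rintro m n hmn D ⟨p, hp, h⟩
      exact ⟨p, hp, by linarith [hmono hmn]⟩)
    (by
      intro n
      obtain ⟨_, ⟨v, hv, rfl⟩, hlt⟩ := exists_lt_of_lt_csSup (hne.image fun v : H × H => B v.1 v.2)
        (sub_lt_self J (Nat.one_div_pos_of_nat (α := ℝ) (n := n)))
      exact ⟨v.2, v.1, hv, hlt.le⟩)
    (by
      rintro n D ⟨p, hp, -⟩
      exact (hR _ hp).2)
    (by
      rintro n D ⟨p, hp, h⟩ D' ⟨p', hp', h'⟩
      obtain ⟨p₁, hp₁, h₁⟩ := hmid _ hp _ hp'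
      exact ⟨p₁, hp₁, by dsimp only at h₁; linarith⟩)
  choose P hP hPJ using hD
  -- This is the total loss from `J` when `D n` is replaced by `D₀` in the second slot of `B (P n)`.
  have hzero : Tendsto (fun n : ℕ => 1 / ((n : ℝ) + 1) + ‖B‖ * R * ‖D n - D₀‖) atTop (𝓝 0) := by
    have h1 := (tendsto_iff_norm_sub_tendsto_zero.1 hDlim).const_mul (‖B‖ * R)
    simpa using (tendsto_one_div_add_atTop_nhds_zero_nat (𝕜 := ℝ)).add h1
  -- `(p, D₀)` need not lie in `C` for these `p`; a companion `D'` within `1 / (n + 1)` of `D₀`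
  -- keeps the pair in `C`, and closedness recovers `D₀` in the limit.
  obtain ⟨p, p₀, hp, hplim⟩ := exists_tendsto_of_antitone_midpoint_convex
    (E := fun n : ℕ => {p : H | ∃ D', (p, D') ∈ C ∧ ‖D' - D₀‖ ≤ 1 / ((n : ℝ) + 1) ∧
      J - 1 / ((n : ℝ) + 1) ≤ B p D₀}) (R := R)
    (by
      rintro m n hmn p ⟨D', h, h', h''⟩
      exact ⟨D', h, h'.trans (hmono hmn), by linarith [hmono hmn]⟩)
    (by
      intro n
      have hpos := Nat.one_div_pos_of_nat (α := ℝ) (n := n)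
      obtain ⟨k, hk₁, hk₂⟩ := ((hzero.eventually (gt_mem_nhds hpos)).and
        ((tendsto_iff_norm_sub_tendsto_zero.1 hDlim).eventually (gt_mem_nhds hpos))).exists
      refine ⟨P k, D k, hP k, hk₂.le, ?_⟩
      have h1 := hBbound (P k) (D k - D₀) (hR _ (hP k)).1
      rw [map_sub, abs_le] at h1
      linarith [hPJ k, h1.2])
    (by
      rintro n p ⟨D', h, -⟩
      exact (hR _ h).1)
    (by
      rintro n p ⟨D', h, h', h''⟩ p₁ ⟨D₁, h₁, h₁', h₁''⟩
      refine ⟨(2⁻¹ : ℝ) • (D' + D₁), ?_, ?_, ?_⟩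
      · have := hconv h h₁ (show (0 : ℝ) ≤ 2⁻¹ by norm_num) (show (0 : ℝ) ≤ 2⁻¹ by norm_num)
          (by norm_num)
        simpa [smul_add] using this
      · have : (2⁻¹ : ℝ) • (D' + D₁) - D₀ = (2⁻¹ : ℝ) • ((D' - D₀) + (D₁ - D₀)) := by
          module
        rw [this, norm_smul]
        have := norm_add_le (D' - D₀) (D₁ - D₀)
        norm_num
        norm_num at h' h₁'
        linarith
      · simp only [map_smul, map_add, smul_apply, add_apply,
          smul_eq_mul]
        linarith)
  choose D' hD'C hD' hpJ using hp
  have hD'lim : Tendsto D' atTop (𝓝 D₀) := by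
    rw [tendsto_iff_norm_sub_tendsto_zero]
    exact squeeze_zero (fun _ => norm_nonneg _) hD' tendsto_one_div_add_atTop_nhds_zero_nat
  refine ⟨(p₀, D₀), hclosed.mem_of_tendsto (hplim.prodMk_nhds hD'lim)
    (Eventually.of_forall hD'C), fun w hw => ?_⟩
  have hJle : J ≤ B p₀ D₀ := by
    have h1 : Tendsto (fun n => B (p n) D₀) atTop (𝓝 (B p₀ D₀)) :=
      ((B.flip D₀).continuous.tendsto p₀).comp hplim
    have h2 : Tendsto (fun n : ℕ => J - 1 / ((n : ℝ) + 1)) atTop (𝓝 (J - 0)) :=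
      tendsto_const_nhds.sub tendsto_one_div_add_atTop_nhds_zero_nat
    rw [sub_zero] at h2
    exact le_of_tendsto_of_tendsto' h2 h1 hpJ
  exact (le_csSup hVbdd ⟨w, hw, rfl⟩).trans hJle

end Hilbert

/-! ### Almost everywhere convergence along subsequences. -/

section Lp

/-- An `L²`-convergent sequence of pairs has a subsequence that converges almost everywhere in
both coordinates. -/
theorem exists_subseq_tendsto_ae_prod {α : Type*} [MeasurableSpace α] {μ : Measure α}
    {v : ℕ → Lp ℝ 2 μ × Lp ℝ 2 μ} {a : Lp ℝ 2 μ × Lp ℝ 2 μ} (hv : Tendsto v atTop (𝓝 a)) :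
    ∃ k : ℕ → ℕ, ∀ᵐ t ∂μ, Tendsto (fun n => (v (k n)).1 t) atTop (𝓝 (a.1 t)) ∧
      Tendsto (fun n => (v (k n)).2 t) atTop (𝓝 (a.2 t)) := by
  have h1 := (continuous_fst.tendsto a).comp hv
  have h2 := (continuous_snd.tendsto a).comp hv
  obtain ⟨k, hk, hk'⟩ := (tendstoInMeasure_of_tendsto_Lp h1).exists_seq_tendsto_ae
  obtain ⟨l, hl, hl'⟩ :=
    (tendstoInMeasure_of_tendsto_Lp (h2.comp hk.tendsto_atTop)).exists_seq_tendsto_ae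
  refine ⟨k ∘ l, ?_⟩
  filter_upwards [hk', hl'] with t ht ht'
  exact ⟨ht.comp hl.tendsto_atTop, ht'⟩

end Lp

/-! ### Revenue as a bounded bilinear form. -/

namespace Market

variable {S : Type*} {m : ℕ} (M : Market S m)

theorem integrable_revenue (p D : M.Traj) :
    IntegrableOn (fun t => Real.exp (-M.ρ * t) * (p t * D t)) (Set.Icc M.t₀ M.tf) := by
  have h : IntegrableOn (fun t => p t * D t) (Set.Icc M.t₀ M.tf) :=
    (Lp.memLp p).integrable_mul (Lp.memLp D)
  exact h.continuousOn_mul (by fun_prop) isCompact_Icc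

/-- Revenue is a bounded bilinear form in price and realized demand. -/
theorem exists_revenue_eq_bilinear :
    ∃ B : M.Traj →L[ℝ] M.Traj →L[ℝ] ℝ, ∀ v, M.revenue v = B v.1 v.2 := by
  obtain ⟨c, hc⟩ := isCompact_Icc.exists_bound_of_continuousOn
    (f := fun t => Real.exp (-M.ρ * t)) (s := Set.Icc M.t₀ M.tf) (by fun_prop)
  have hbound : ∀ p D : M.Traj, ‖M.revenue (p, D)‖ ≤ max c 0 * ‖p‖ * ‖D‖ := by
    intro p D
    have hint : Integrable (fun t => |p t| * |D t|) (periodMeasure M.t₀ M.tf) :=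
      (Lp.memLp p).abs.integrable_mul (Lp.memLp D).abs
    have habs : ∫ t in Set.Icc M.t₀ M.tf, |p t| * |D t| ≤ ‖p‖ * ‖D‖ := by
      have h1 : ∫ t in Set.Icc M.t₀ M.tf, |p t| * |D t| = inner ℝ (|p| : M.Traj) |D| := by
        rw [L2.inner_def]
        refine integral_congr_ae ?_
        filter_upwards [Lp.coeFn_abs p, Lp.coeFn_abs D] with t h1 h2
        simp [h1, h2, mul_comm]
      rw [h1]
      refine (real_inner_le_norm _ _).trans (by rw [norm_abs_eq_norm, norm_abs_eq_norm])
    rw [mul_assoc]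
    refine (norm_integral_le_of_norm_le (hint.const_mul (max c 0)) ?_).trans ?_
    · filter_upwards [ae_restrict_mem measurableSet_Icc] with t ht
      rw [norm_mul, norm_mul, Real.norm_eq_abs (p t), Real.norm_eq_abs (D t)]
      gcongr
      exact (hc t ht).trans (le_max_left _ _)
    · rw [integral_const_mul]
      gcongr
  refine ⟨LinearMap.mkContinuous₂ (LinearMap.mk₂ ℝ (fun p D => M.revenue (p, D)) ?_ ?_ ?_ ?_)
    (max c 0) hbound, fun v => rfl⟩
  · intro p p' D
    rw [revenue, revenue, revenue, ← integral_add (M.integrable_revenue p D)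
      (M.integrable_revenue p' D)]
    refine integral_congr_ae ?_
    filter_upwards [Lp.coeFn_add p p'] with t ht
    simp only [ht, Pi.add_apply]
    ring
  · intro a p D
    rw [revenue, revenue, smul_eq_mul, ← integral_const_mul]
    refine integral_congr_ae ?_
    filter_upwards [Lp.coeFn_smul a p] with t ht
    simp only [ht, Pi.smul_apply, smul_eq_mul]
    ring
  · intro p D D'
    rw [revenue, revenue, revenue, ← integral_add (M.integrable_revenue p D)
      (M.integrable_revenue p D')]
    refine integral_congr_ae ?_
    filter_upwards [Lp.coeFn_add D D'] with t ht
    simp only [ht, Pi.add_apply]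
    ring
  · intro a p D
    rw [revenue, revenue, smul_eq_mul, ← integral_const_mul]
    refine integral_congr_ae ?_
    filter_upwards [Lp.coeFn_smul a D] with t ht
    simp only [ht, Pi.smul_apply, smul_eq_mul]
    ring

/-! ### Feasible prices and convex combinations. -/

variable {M}

theorem FeasiblePrice.norm_le {p : M.Traj} (hp : M.FeasiblePrice p) (h0 : 0 ≤ M.pMin) :
    ‖p‖ ≤ ‖(memLp_const M.pMax : MemLp _ 2 (periodMeasure M.t₀ M.tf)).toLp‖ := by
  refine Lp.norm_le_norm_of_ae_le ?_
  filter_upwards [hp, MemLp.coeFn_toLp (memLp_const M.pMax : MemLp _ 2 (periodMeasure M.t₀ M.tf))]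
    with t ht ht'
  rw [ht', Real.norm_eq_abs, Real.norm_eq_abs, abs_of_nonneg (h0.trans ht.1)]
  exact ht.2.trans (le_abs_self _)

/-- The period has positive measure, so the bounds hold at some time. This makes the constant price
`pMin` feasible. -/
theorem FeasiblePrice.pMin_le_pMax {p : M.Traj} (hp : M.FeasiblePrice p) (h : M.t₀ < M.tf) :
    M.pMin ≤ M.pMax := by
  have : (ae (periodMeasure M.t₀ M.tf)).NeBot := by
    rw [ae_neBot]
    intro h0
    have h1 := congrArg (fun μ => μ Set.univ) h0
    simp [h.not_ge] at h1
  obtain ⟨t, ht⟩ := hp.exists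
  exact ht.1.trans ht.2

theorem ae_forall_feasible [Finite S] {s : S} {q : M.Others s} (hq : ∀ r, M.FeasiblePrice (q r)) :
    ∀ᵐ t ∂(periodMeasure M.t₀ M.tf), ∀ r, M.pMin ≤ q r t ∧ q r t ≤ M.pMax :=
  ae_all_iff.2 hq

theorem coeFn_convexComb (D D' : M.Traj) (a b : ℝ) :
    ∀ᵐ t ∂(periodMeasure M.t₀ M.tf), (a • D + b • D' : M.Traj) t = a * D t + b * D' t := by
  filter_upwards [Lp.coeFn_add (a • D) (b • D'), Lp.coeFn_smul a D, Lp.coeFn_smul b D']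
    with t h1 h2 h3
  rw [h1, Pi.add_apply, h2, h3, Pi.smul_apply, Pi.smul_apply, smul_eq_mul, smul_eq_mul]

theorem integral_add_smul (D D' : M.Traj) (a b : ℝ) :
    ∫ t in Set.Icc M.t₀ M.tf, (a • D + b • D' : M.Traj) t =
      a * (∫ t in Set.Icc M.t₀ M.tf, D t) + b * ∫ t in Set.Icc M.t₀ M.tf, D' t := by
  have hi : ∀ D : M.Traj, Integrable D (periodMeasure M.t₀ M.tf) := fun D =>
    (Lp.memLp D).integrable (by norm_num)
  rw [← integral_const_mul, ← integral_const_mul,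
    ← integral_add ((hi D).const_mul a) ((hi D').const_mul b)]
  exact integral_congr_ae (coeFn_convexComb D D' a b)

/-! ### Boundedness, closedness and convexity of the strategy set; midpoint strategies. -/

variable [DecidableEq S]

theorem priceAt_congr {s : S} {p p' : M.Traj} {q : M.Others s} {t : ℝ} (h : p t = p' t) :
    M.priceAt s p q t = M.priceAt s p' q t := by
  funext r
  simp only [priceAt, h]

theorem demand_congr {s : S} {p p' : M.Traj} {q : M.Others s} {ξ : M.Unc} {t : ℝ}
    (h : p t = p' t) : M.demand s p q ξ t = M.demand s p' q ξ t := by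
  rw [demand, demand, priceAt_congr h]

theorem priceAt_mem_Icc {s : S} {p : M.Traj} {q : M.Others s} {t : ℝ}
    (hp : M.pMin ≤ p t ∧ p t ≤ M.pMax) (hq : ∀ r, M.pMin ≤ q r t ∧ q r t ≤ M.pMax) :
    M.priceAt s p q t ∈ Set.Icc (fun _ : S => M.pMin) (fun _ => M.pMax) := by
  constructor <;> intro r <;> simp only [priceAt] <;> split_ifs
  exacts [hp.1, (hq _).1, hp.2, (hq _).2]

/-- Own-price monotonicity bounds the observed demand by the demand at the lowest price. -/
theorem Regular.demand_le_of_ae_eq_pMin (hM : M.Regular) {s : S} {q : M.Others s}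
    (hq : ∀ r, M.FeasiblePrice (q r)) {ξ : M.Unc} (hξ : ξ ∈ M.U s) {p₀ p : M.Traj}
    (hp : M.FeasiblePrice p) (hp₀ : M.FeasiblePrice p₀)
    (hp₀' : ∀ᵐ t ∂(periodMeasure M.t₀ M.tf), p₀ t = M.pMin) :
    ∀ᵐ t ∂(periodMeasure M.t₀ M.tf), M.demand s p q ξ t ≤ M.demand s p₀ q ξ t := by
  classical
  set μ := periodMeasure M.t₀ M.tf
  obtain ⟨f, hf, hfeq⟩ := (hM.demand_memLp s p q hp hq ξ hξ).1.aemeasurable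
  obtain ⟨g, hg, hgeq⟩ := (hM.demand_memLp s p₀ q hp₀ hq ξ hξ).1.aemeasurable
  -- `A` is where the claim fails, in terms of measurable representatives. The test price `p'`
  -- deviates from `p₀` only there.
  set A : Set ℝ := {t | g t < f t} with hA
  have hAm : MeasurableSet A := measurableSet_lt hg hf
  have hmem : MemLp (A.piecewise p p₀) 2 μ :=
    ((Lp.memLp p).restrict A).piecewise hAm ((Lp.memLp p₀).restrict Aᶜ)
  set p' : M.Traj := hmem.toLp with hp'
  have hp'eq : ∀ᵐ t ∂μ, p' t = A.piecewise p p₀ t := hmem.coeFn_toLp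
  have hp'f : M.FeasiblePrice p' := by
    filter_upwards [hp'eq, hp, hp₀] with t h h1 h2
    rw [h]
    by_cases ht : t ∈ A <;> simpa [ht]
  -- Demand at time `t` depends only on prices at `t`, so on `A` both factors of the monotonicity
  -- integrand are nonnegative, and off `A` it vanishes. Hence `p = p₀` almost everywhere on `A`,
  -- where the two demands then agree.
  have heq : p' = p₀ := by
    by_contra hne
    refine (hM.demand_strictAnti s q hq ξ hξ p' p₀ hp'f hp₀ hne).not_ge (integral_nonneg_of_ae ?_)
    filter_upwards [hp'eq, hp, hp₀', hfeq, hgeq] with t h h1 h2 h3 h4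
    by_cases ht : t ∈ A
    · rw [Set.piecewise_eq_of_mem _ _ _ ht] at h
      have h5 : g t < f t := ht
      rw [demand_congr h, h, h3, h4, h2]
      exact mul_nonneg (Real.exp_pos _).le
        (mul_nonneg (sub_nonneg.2 h5.le) (sub_nonneg.2 h1.1))
    · rw [Set.piecewise_eq_of_notMem _ _ _ ht] at h
      simp [h]
  rw [heq] at hp'eq
  filter_upwards [hp'eq, hfeq, hgeq] with t h h1 h2
  by_cases ht : t ∈ A
  · rw [Set.piecewise_eq_of_mem _ _ _ ht] at h
    rw [demand_congr h]
  · rw [h1, h2]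
    exact not_lt.1 ht

theorem Regular.isClosed_strategySet [Finite S] (hM : M.Regular) {s : S} {q : M.Others s}
    (hq : ∀ r, M.FeasiblePrice (q r)) {W : Set M.Unc} (hW : W ⊆ M.U s) :
    IsClosed (M.strategySet s q W) := by
  refine IsSeqClosed.isClosed fun v a hv hva => ?_
  obtain ⟨k, hk⟩ := exists_subseq_tendsto_ae_prod hva
  have hfeas : ∀ᵐ t ∂(periodMeasure M.t₀ M.tf), ∀ n, M.pMin ≤ (v n).1 t ∧ (v n).1 t ≤ M.pMax :=
    ae_all_iff.2 fun n => (hv n).1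
  have hfeas' : M.FeasiblePrice a.1 := by
    filter_upwards [hk, hfeas] with t ht h
    exact ⟨ge_of_tendsto' ht.1 fun n => (h _).1, le_of_tendsto' ht.1 fun n => (h _).2⟩
  refine ⟨hfeas', ?_, ?_, ?_⟩
  -- The inventory constraint is an inner product with the constant `1`, hence continuous in `L²`.
  · have hone : MemLp (fun _ : ℝ => (1 : ℝ)) 2 (periodMeasure M.t₀ M.tf) := memLp_const 1
    have hint : ∀ D : M.Traj, ∫ t in Set.Icc M.t₀ M.tf, D t = inner ℝ hone.toLp D := by
      intro D
      rw [L2.inner_def]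
      refine integral_congr_ae ?_
      filter_upwards [hone.coeFn_toLp] with t ht
      rw [ht]
      simp only [RCLike.inner_apply, map_one, mul_one]
    have hlim : Tendsto (fun n => inner ℝ hone.toLp (v n).2) atTop (𝓝 (inner ℝ hone.toLp a.2)) :=
      tendsto_const_nhds.inner ((continuous_snd.tendsto a).comp hva)
    have hconst : ∀ n, inner ℝ hone.toLp (v n).2 = M.K s := fun n => by
      rw [← hint]
      exact (hv n).2.1
    simp only [hconst] at hlim
    rw [hint]
    exact tendsto_nhds_unique hlim tendsto_const_nhds
  · filter_upwards [hk, ae_all_iff.2 fun n => (hv n).2.2.1] with t ht h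
    exact ge_of_tendsto' ht.2 fun n => h _
  · intro ξ hξ
    filter_upwards [hk, ae_all_iff.2 fun n => (hv n).2.2.2 ξ hξ, hfeas, hfeas',
      ae_forall_feasible hq, hM.demand_continuous s ξ (hW hξ)] with t ht h h1 h2 h3 h4
    -- Demand is continuous only on the price box, so the convergence must be within it.
    have hlim : Tendsto (fun n => M.priceAt s (v (k n)).1 q t) atTop
        (𝓝[Set.Icc (fun _ => M.pMin) (fun _ => M.pMax)] (M.priceAt s a.1 q t)) := by
      refine tendsto_nhdsWithin_iff.2
        ⟨tendsto_pi_nhds.2 fun r => ?_, Eventually.of_forall fun n => priceAt_mem_Icc (h1 _) h3⟩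
      by_cases hr : r = s
      · simpa [priceAt, hr] using ht.1
      · simp [priceAt, hr]
    exact le_of_tendsto_of_tendsto' ht.2 ((h4 _ (priceAt_mem_Icc h2 h3)).tendsto.comp hlim)
      fun n => h _

/-- Concavity of demand in the own price, at a fixed time. -/
theorem le_demand_of_convexComb {s : S} {q : M.Others s} {ξ : M.Unc} {t : ℝ} {p p₁ p₂ : M.Traj}
    (hc : ConcaveOn ℝ (Set.Icc (fun _ => M.pMin) (fun _ => M.pMax)) (fun x : S → ℝ => M.h s t x ξ))
    (h₁ : M.pMin ≤ p₁ t ∧ p₁ t ≤ M.pMax) (h₂ : M.pMin ≤ p₂ t ∧ p₂ t ≤ M.pMax)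
    (hq : ∀ r, M.pMin ≤ q r t ∧ q r t ≤ M.pMax) {a b : ℝ} (ha : 0 ≤ a) (hb : 0 ≤ b)
    (hab : a + b = 1) (hp : p t = a * p₁ t + b * p₂ t) :
    a * M.demand s p₁ q ξ t + b * M.demand s p₂ q ξ t ≤ M.demand s p q ξ t := by
  have h := hc.2 (priceAt_mem_Icc h₁ hq) (priceAt_mem_Icc h₂ hq) ha hb hab
  have heq : M.priceAt s p q t = a • M.priceAt s p₁ q t + b • M.priceAt s p₂ q t := by
    funext r
    by_cases hr : r = s
    · simp [priceAt, hr, hp]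
    · simp [priceAt, hr, ← add_mul, hab]
  rwa [← heq] at h

theorem Regular.convex_strategySet [Finite S] (hM : M.Regular) {s : S} {q : M.Others s}
    (hq : ∀ r, M.FeasiblePrice (q r)) {W : Set M.Unc} (hW : W ⊆ M.U s) :
    Convex ℝ (M.strategySet s q W) := by
  intro v hv w hw a b ha hb hab
  refine ⟨?_, ?_, ?_, fun ξ hξ => ?_⟩
  · filter_upwards [hv.1, hw.1, coeFn_convexComb v.1 w.1 a b] with t h1 h2 h3
    simp only [Prod.fst_add, Prod.smul_fst, h3]
    exact (convex_Icc M.pMin M.pMax) h1 h2 ha hb hab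
  · simp only [Prod.snd_add, Prod.smul_snd]
    rw [integral_add_smul, hv.2.1, hw.2.1, ← add_mul, hab, one_mul]
  · filter_upwards [hv.2.2.1, hw.2.2.1, coeFn_convexComb v.2 w.2 a b] with t h1 h2 h3
    simp only [Prod.snd_add, Prod.smul_snd, h3]
    exact (convex_Ici M.dMin) h1 h2 ha hb hab
  · filter_upwards [hv.1, hw.1, coeFn_convexComb v.1 w.1 a b, coeFn_convexComb v.2 w.2 a b,
      hv.2.2.2 ξ hξ, hw.2.2.2 ξ hξ, ae_forall_feasible hq, hM.demand_concave s ξ (hW hξ)]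
      with t h1 h2 h3 h4 h5 h6 h7 h8
    simp only [Prod.snd_add, Prod.smul_snd, Prod.fst_add, Prod.smul_fst, h4]
    refine le_trans ?_ (le_demand_of_convexComb h8 h1 h2 h7 ha hb hab h3)
    gcongr

/-- The midpoint of the demands of two strategies can be sold with at least the mean revenue: take
the mean price, except that the higher price is taken where it comes with the higher demand. -/
theorem Regular.exists_midpoint_strategy [Finite S] (hM : M.Regular) {s : S} {q : M.Others s}
    (hq : ∀ r, M.FeasiblePrice (q r)) {W : Set M.Unc} (hW : W ⊆ M.U s) {v w : M.Traj × M.Traj}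
    (hv : v ∈ M.strategySet s q W) (hw : w ∈ M.strategySet s q W) :
    ∃ p, (p, (2⁻¹ : ℝ) • (v.2 + w.2)) ∈ M.strategySet s q W ∧
      (M.revenue v + M.revenue w) / 2 ≤ M.revenue (p, (2⁻¹ : ℝ) • (v.2 + w.2)) := by
  classical
  set μ := periodMeasure M.t₀ M.tf
  set A : Set ℝ := {t | 0 < (v.1 t - w.1 t) * (v.2 t - w.2 t)} with hA
  have hm : ∀ f : M.Traj, Measurable f := fun f => (Lp.stronglyMeasurable f).measurable
  have hAm : MeasurableSet A := measurableSet_lt measurable_const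
    (((hm _).sub (hm _)).mul ((hm _).sub (hm _)))
  have hmem : MemLp (A.piecewise (v.1 ⊔ w.1 : M.Traj) ((2⁻¹ : ℝ) • v.1 + (2⁻¹ : ℝ) • w.1 : M.Traj))
      2 μ := ((Lp.memLp _).restrict A).piecewise hAm ((Lp.memLp _).restrict Aᶜ)
  set p : M.Traj := hmem.toLp
  have hpA : ∀ᵐ t ∂μ, t ∈ A → p t = max (v.1 t) (w.1 t) := by
    filter_upwards [hmem.coeFn_toLp, Lp.coeFn_sup v.1 w.1] with t h h' ht
    rw [h, Set.piecewise_eq_of_mem _ _ _ ht, h']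
    rfl
  have hpA' : ∀ᵐ t ∂μ, t ∉ A → p t = 2⁻¹ * v.1 t + 2⁻¹ * w.1 t := by
    filter_upwards [hmem.coeFn_toLp, coeFn_convexComb v.1 w.1 2⁻¹ 2⁻¹] with t h h' ht
    rw [h, Set.piecewise_eq_of_notMem _ _ _ ht, h']
  rw [smul_add]
  have hD := coeFn_convexComb v.2 w.2 2⁻¹ 2⁻¹
  set D : M.Traj := (2⁻¹ : ℝ) • v.2 + (2⁻¹ : ℝ) • w.2 with hDdef
  have hconv := hM.convex_strategySet hq hW hv hw (show (0 : ℝ) ≤ 2⁻¹ by norm_num)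
    (show (0 : ℝ) ≤ 2⁻¹ by norm_num) (by norm_num)
  refine ⟨p, ⟨?_, hconv.2.1, hconv.2.2.1, fun ξ hξ => ?_⟩, ?_⟩
  · filter_upwards [hv.1, hw.1, hpA, hpA'] with t h1 h2 h3 h4
    by_cases ht : t ∈ A
    · simp only [h3 ht]
      exact ⟨h1.1.trans (le_max_left _ _), max_le h1.2 h2.2⟩
    · simp only [h4 ht]
      constructor <;> linarith [h1.1, h1.2, h2.1, h2.2]
  · filter_upwards [hv.1, hw.1, hpA, hpA', hD, hv.2.2.2 ξ hξ, hw.2.2.2 ξ hξ,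
      ae_forall_feasible hq, hM.demand_concave s ξ (hW hξ)] with t h1 h2 h3 h4 h5 h6 h7 h8 h9
    simp only [h5]
    by_cases ht : t ∈ A
    -- On `A` the strategy with the higher price also has the higher demand, and that demand, which
    -- is at least the mean, is feasible at that price.
    · have h3 := h3 ht
      have ht' : 0 < (v.1 t - w.1 t) * (v.2 t - w.2 t) := ht
      rcases le_total (v.1 t) (w.1 t) with hle | hle
      · rw [max_eq_right hle] at h3
        rw [demand_congr h3]
        have : v.2 t ≤ w.2 t := by
          by_contra! hlt
          nlinarith [mul_nonneg (sub_nonneg.2 hle) (sub_nonneg.2 hlt.le)]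
        linarith
      · rw [max_eq_left hle] at h3
        rw [demand_congr h3]
        have : w.2 t ≤ v.2 t := by
          by_contra! hlt
          nlinarith [mul_nonneg (sub_nonneg.2 hle) (sub_nonneg.2 hlt.le)]
        linarith
    · refine le_trans ?_ (le_demand_of_convexComb h9 h1 h2 h8 (by norm_num) (by norm_num)
        (by norm_num) (h4 ht))
      gcongr
  · have h2 : (M.revenue v + M.revenue w) / 2 = ∫ t in Set.Icc M.t₀ M.tf,
        (Real.exp (-M.ρ * t) * (v.1 t * v.2 t) + Real.exp (-M.ρ * t) * (w.1 t * w.2 t)) / 2 := by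
      rw [integral_div, integral_add (M.integrable_revenue _ _) (M.integrable_revenue _ _)]
      rfl
    rw [h2]
    refine integral_mono_ae (((M.integrable_revenue _ _).add (M.integrable_revenue _ _)).div_const 2)
      (M.integrable_revenue _ _) ?_
    filter_upwards [hpA, hpA', hD, hv.2.2.1, hw.2.2.1] with t h3 h4 h5 h6 h7
    rw [← mul_add, mul_div_assoc]
    refine mul_le_mul_of_nonneg_left ?_ (Real.exp_pos _).le
    have hd := hM.dMin_pos
    simp only [h5]
    by_cases ht : t ∈ A
    · rw [h3 ht]
      have h8 := mul_le_mul_of_nonneg_right (le_max_left (v.1 t) (w.1 t)) (hd.le.trans h6)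
      have h9 := mul_le_mul_of_nonneg_right (le_max_right (v.1 t) (w.1 t)) (hd.le.trans h7)
      linarith
    -- The product of the means exceeds the mean of the products by `-(v.1 t - w.1 t) * (v.2 t - w.2
    -- t) / 4`, nonnegative off `A`.
    · rw [h4 ht]
      have ht' : (v.1 t - w.1 t) * (v.2 t - w.2 t) ≤ 0 := not_lt.1 ht
      linarith

theorem Regular.exists_best_response [Finite S] (hM : M.Regular) {s : S} {q : M.Others s}
    (hq : ∀ r, M.FeasiblePrice (q r)) {W : Set M.Unc} (hW : W ⊆ M.U s) (hWne : W.Nonempty)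
    (hne : (M.strategySet s q W).Nonempty) :
    ∃ v ∈ M.strategySet s q W, ∀ w ∈ M.strategySet s q W, M.revenue w ≤ M.revenue v := by
  obtain ⟨B, hB⟩ := M.exists_revenue_eq_bilinear
  obtain ⟨ξ, hξ⟩ := hWne
  have hle : M.pMin ≤ M.pMax := hne.some_mem.1.pMin_le_pMax hM.t₀_lt_tf
  have hmin : MemLp (fun _ : ℝ => M.pMin) 2 (periodMeasure M.t₀ M.tf) := memLp_const _
  have hp₀' : ∀ᵐ t ∂(periodMeasure M.t₀ M.tf), (hmin.toLp : M.Traj) t = M.pMin := hmin.coeFn_toLp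
  have hp₀ : M.FeasiblePrice hmin.toLp := by
    filter_upwards [hp₀'] with t ht
    rw [ht]
    exact ⟨le_rfl, hle⟩
  have hg := hM.demand_memLp s _ q hp₀ hq ξ (hW hξ)
  -- A single `ξ ∈ W` suffices: demand at the lowest price dominates every admissible `v.2`.
  have hbound : ∀ v ∈ M.strategySet s q W, ‖v.2‖ ≤ ‖hg.toLp‖ := by
    intro v hv
    refine Lp.norm_le_norm_of_ae_le ?_
    filter_upwards [hv.2.2.1, hv.2.2.2 ξ hξ, hg.coeFn_toLp,
      hM.demand_le_of_ae_eq_pMin hq (hW hξ) hv.1 hp₀ hp₀'] with t h1 h2 h3 h4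
    rw [h3, Real.norm_eq_abs, Real.norm_eq_abs, abs_of_nonneg (hM.dMin_pos.le.trans h1)]
    exact (h2.trans h4).trans (le_abs_self _)
  simp only [hB]
  refine exists_isMax_bilinear B hne (hM.isClosed_strategySet hq hW) (hM.convex_strategySet hq hW)
    (R := max _ ‖hg.toLp‖)
    (fun v hv => ⟨(hv.1.norm_le hM.pMin_nonneg).trans (le_max_left _ _),
      (hbound v hv).trans (le_max_right _ _)⟩) fun v hv w hw => ?_
  simpa only [hB] using hM.exists_midpoint_strategy hq hW hv hw

end Market

/-- Existence of a best response: for a fixed uncertainty vector `ξ ∈ U_s`, and also when the demand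
constraint is imposed for all uncertainty vectors in `U_s` simultaneously. -/
theorem theorem2 {S : Type*} [Finite S] [DecidableEq S] {m : ℕ} (M : Market S m)
    (hM : M.Regular) (s : S) (q : M.Others s) (hq : ∀ r, M.FeasiblePrice (q r)) :
    (∀ ξ ∈ M.U s, (M.strategySet s q {ξ}).Nonempty →
      ∃ v ∈ M.strategySet s q {ξ}, ∀ w ∈ M.strategySet s q {ξ}, M.revenue w ≤ M.revenue v) ∧
    ((M.strategySet s q (M.U s)).Nonempty →
      ∃ v ∈ M.strategySet s q (M.U s), ∀ w ∈ M.strategySet s q (M.U s),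
        M.revenue w ≤ M.revenue v) := by
  exact ⟨fun ξ hξ => hM.exists_best_response hq (Set.singleton_subset_iff.2 hξ)
    (Set.singleton_nonempty ξ), hM.exists_best_response hq subset_rfl (hM.U_nonempty s)⟩
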